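/- Let $\Bbbk$ be an algebraically closed field, $G$ an affine algebraic group over $\Bbbk$ with algebra of polynomial functions $\Bbbk[G]$, and $H\subseteq G$ a closed subgroup, so that $\Bbbk[H]$ consists of the restrictions to $H$ of the elements of $\Bbbk[G]$. A (not necessarily finite dimensional) rational $G$-module is a linear representation $M$ of $G$ whose action is given by a right $\Bbbk[G]$-comodule structure $\chi(m)=\sum m_0\otimes m_1\in M\otimes\Bbbk[G]$ through $x\cdot m=\sum m_0\,m_1(x)$, and similarly for $H$; ${}^GM$ and ${}^HM$ denote the subspaces of invariants. The group $G$ acts on $\Bbbk[G]$ by $(x\cdot f)(y)=f(yx)$, $H$ acts on $\Bbbk[H]$ by the same formula, and $\Bbbk[G]$ is regarded as an $H$-module by restriction. Then the following three conditions are equivalent: 1. $H$ is strongly observable in $G$: for every rational $H$-module $M$ there are a rational $G$-module $N$ and an injective $H$-equivariant linear map $\iota: M\to N|_H$ with $\iota({}^HM)\subseteq {}^GN$; 2. there is a total integral for $H$ with values in $\Bbbk[G]$: a $\Bbbk$-linear map $\sigma:\Bbbk[H]\to\Bbbk[G]$ with $\sigma(x\cdot f)=x\cdot\sigma(f)$ for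 all $x\in H$, $f\in\Bbbk[H]$, and $\sigma(1)=1$; 3. $\Bbbk[G]$ is an injective object of the category of rational $H$-modules: for every injective morphism $i:X\to Y$ of rational $H$-modules and every morphism $f:X\to\Bbbk[G]$ of $H$-modules there is a morphism $g:Y\to\Bbbk[G]$ of $H$-modules with $g\circ i=f$. -/

import Mathlib

open scoped TensorProduct

universe u v w

/-- The structure of an affine algebraic group over `k` on a group `G` (for `k` algebraically
closed): a finitely generated algebra `coordRing` of `k`-valued functions on `G`, the polynomial
functions, such that the points of `G` are exactly the `k`-algebra maps `coordRing → k` (so `G` is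
an affine variety with this coordinate ring), and such that multiplication and inversion are
morphisms of varieties. -/
structure AffineAlgebraicGroup (k : Type u) (G : Type v) [Field k] [Group G] where
  /-- the algebra `k[G]` of polynomial functions -/
  coordRing : Subalgebra k (G → k)
  fg : coordRing.FG
  eval_bijective : Function.Bijective
    (fun x : G => ((Pi.evalAlgHom k (fun _ : G => k) x).comp coordRing.val : coordRing →ₐ[k] k))
  exists_mul : ∀ f ∈ coordRing, ∃ (n : ℕ) (a b : Fin n → coordRing),
    ∀ x y : G, f (x * y) = ∑ i, (a i : G → k) x * (b i : G → k) y
  inv_mem : ∀ f ∈ coordRing, (fun x => f x⁻¹) ∈ coordRing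

namespace AffineAlgebraicGroup

variable {k : Type u} {G : Type v} [Field k] [Group G]

/-- Evaluation of polynomial functions at the point `x`. -/
def evalAt (𝒢 : AffineAlgebraicGroup k G) (x : G) : 𝒢.coordRing →ₐ[k] k :=
  (Pi.evalAlgHom k (fun _ : G => k) x).comp 𝒢.coordRing.val

/-- A subgroup is closed if it is the zero set of a set of polynomial functions. -/
def IsClosedSubgroup (𝒢 : AffineAlgebraicGroup k G) (H : Subgroup G) : Prop :=
  ∃ S : Set 𝒢.coordRing, ∀ x : G, x ∈ H ↔ ∀ f ∈ S, 𝒢.evalAt x f = 0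

/-- Restriction of functions from `G` to the subgroup `H`. -/
def restrictFun (k : Type u) {G : Type v} [Field k] [Group G] (H : Subgroup G) :
    (G → k) →ₐ[k] (H → k) where
  toFun f := fun x => f x
  map_one' := rfl
  map_mul' _ _ := rfl
  map_zero' := rfl
  map_add' _ _ := rfl
  commutes' _ := rfl

/-- A closed subgroup `H` of `G` is an affine algebraic group, its polynomial functions being the
restrictions to `H` of the polynomial functions on `G`. -/
def closedSubgroup (𝒢 : AffineAlgebraicGroup k G) (H : Subgroup G)
    (hH : 𝒢.IsClosedSubgroup H) : AffineAlgebraicGroup k H where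
  coordRing := 𝒢.coordRing.map (restrictFun k H)
  fg := 𝒢.fg.map _
  eval_bijective := by
    constructor
    · intro x y hxy
      apply Subtype.ext
      apply 𝒢.eval_bijective.1
      ext f
      exact DFunLike.congr_fun hxy
        (⟨restrictFun k H f, Subalgebra.mem_map.2 ⟨f, f.2, rfl⟩⟩ :
          𝒢.coordRing.map (restrictFun k H))
    · intro φ
      let r : 𝒢.coordRing →ₐ[k] 𝒢.coordRing.map (restrictFun k H) :=
        ((restrictFun k H).comp 𝒢.coordRing.val).codRestrict _
          (fun f => Subalgebra.mem_map.2 ⟨f, f.2, rfl⟩)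
      obtain ⟨x, hx⟩ := 𝒢.eval_bijective.2 (φ.comp r)
      obtain ⟨S, hS⟩ := hH
      have hxH : x ∈ H := by
        rw [hS]
        intro f hf
        have h0 : r f = 0 := by
          apply Subtype.ext
          funext y
          exact (hS y).1 y.2 f hf
        have h1 : 𝒢.evalAt x f = φ (r f) := DFunLike.congr_fun hx f
        rw [h1, h0, map_zero]
      refine ⟨⟨x, hxH⟩, ?_⟩
      ext ⟨g, hg⟩
      obtain ⟨f, hf, rfl⟩ := Subalgebra.mem_map.1 hg
      exact DFunLike.congr_fun hx ⟨f, hf⟩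
  exists_mul := by
    intro g hg
    obtain ⟨f, hf, rfl⟩ := Subalgebra.mem_map.1 hg
    obtain ⟨n, a, b, hab⟩ := 𝒢.exists_mul f hf
    exact ⟨n, fun i => ⟨restrictFun k H (a i), Subalgebra.mem_map.2 ⟨a i, (a i).2, rfl⟩⟩,
      fun i => ⟨restrictFun k H (b i), Subalgebra.mem_map.2 ⟨b i, (b i).2, rfl⟩⟩,
      fun x y => hab x y⟩
  inv_mem := by
    intro g hg
    obtain ⟨f, hf, rfl⟩ := Subalgebra.mem_map.1 hg
    exact Subalgebra.mem_map.2 ⟨fun x => f x⁻¹, 𝒢.inv_mem f hf, rfl⟩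

theorem translate_mem (𝒢 : AffineAlgebraicGroup k G) (x : G) (f : 𝒢.coordRing) :
    (fun y => (f : G → k) (y * x)) ∈ 𝒢.coordRing := by
  obtain ⟨n, a, b, hab⟩ := 𝒢.exists_mul f f.2
  have h : (fun y => (f : G → k) (y * x)) = ∑ i, (b i : G → k) x • (a i : G → k) := by
    funext y
    simp [hab, Finset.sum_apply, mul_comm]
  rw [h]
  exact Subalgebra.sum_mem _ fun i _ => Subalgebra.smul_mem _ (a i).2 _

/-- The `G`-module `k[G]`, with the action `(x • f) y = f (y * x)`. -/
def regularRep (𝒢 : AffineAlgebraicGroup k G) : Representation k G 𝒢.coordRing where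
  toFun x :=
    { toFun := fun f => ⟨fun y => (f : G → k) (y * x), 𝒢.translate_mem x f⟩
      map_add' := fun _ _ => rfl
      map_smul' := fun _ _ => rfl }
  map_one' := by
    ext f y
    simp
  map_mul' x x' := by
    ext f y
    simp [mul_assoc]

/-- A `G`-module `M` is rational if its action comes from a coaction `χ : M → M ⊗ k[G]` by the
rule `x • m = ∑ m₀ m₁(x)`. As elements of `M ⊗ k[G]` are determined by their values at the points
of `G`, such a `χ` is unique and automatically coassociative and counital, that is, a right
comodule structure. -/
def IsRational (𝒢 : AffineAlgebraicGroup k G) {M : Type w} [AddCommGroup M] [Module k M]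
    (ρ : Representation k G M) : Prop :=
  ∃ χ : M →ₗ[k] M ⊗[k] 𝒢.coordRing, ∀ (x : G) (m : M),
    ρ x m = TensorProduct.rid k M ((𝒢.evalAt x).toLinearMap.lTensor M (χ m))

/-- The restriction `N|_H` of a `G`-module to a subgroup. -/
def restrictRep {M : Type w} [AddCommGroup M] [Module k M]
    (ρ : Representation k G M) (H : Subgroup G) : Representation k H M :=
  ρ.comp H.subtype

/-- The closed subgroup `H` is strongly observable in `G`: every rational `H`-module `M` embeds
`H`-equivariantly in a rational `G`-module `N` so that `H`-invariants of `M` are sent to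
`G`-invariants of `N`. -/
def StronglyObservable (𝒢 : AffineAlgebraicGroup k G) (H : Subgroup G)
    (hH : 𝒢.IsClosedSubgroup H) : Prop :=
  ∀ (M : Type w) [AddCommGroup M] [Module k M] (ρ : Representation k H M),
    (𝒢.closedSubgroup H hH).IsRational ρ →
    ∃ (N : Type w) (_ : AddCommGroup N) (_ : Module k N) (τ : Representation k G N),
      𝒢.IsRational τ ∧
      ∃ ι : M →ₗ[k] N, Function.Injective ι ∧
        (∀ (x : H) (m : M), ι (ρ x m) = restrictRep τ H x (ι m)) ∧
        ∀ m ∈ ρ.invariants, ι m ∈ τ.invariants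

/-- `σ : k[G] → R` is a total integral with values in the `G`-module algebra `R`: a `k`-linear
`G`-equivariant map with `σ 1 = 1`. -/
def IsTotalIntegral (𝒢 : AffineAlgebraicGroup k G) {R : Type w} [CommRing R] [Algebra k R]
    (ρ : Representation k G R) (σ : 𝒢.coordRing →ₗ[k] R) : Prop :=
  (∀ (x : G) (f : 𝒢.coordRing), σ (𝒢.regularRep x f) = ρ x (σ f)) ∧ σ 1 = 1

/-- The `G`-module `V` is an injective object of the category of rational `G`-modules, tested on
the rational modules of the universe `w`. -/
def IsInjectiveRational (𝒢 : AffineAlgebraicGroup k G) {V : Type*} [AddCommGroup V] [Module k V]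
    (ρ : Representation k G V) : Prop :=
  𝒢.IsRational ρ ∧
  ∀ (X Y : Type w) [AddCommGroup X] [Module k X] [AddCommGroup Y] [Module k Y]
    (ρX : Representation k G X) (ρY : Representation k G Y),
    𝒢.IsRational ρX → 𝒢.IsRational ρY →
    ∀ (i : X →ₗ[k] Y) (f : X →ₗ[k] V), Function.Injective i →
      (∀ (x : G) (m : X), i (ρX x m) = ρY x (i m)) →
      (∀ (x : G) (m : X), f (ρX x m) = ρ x (f m)) →
      ∃ g : Y →ₗ[k] V, (∀ (x : G) (m : Y), g (ρY x m) = ρ x (g m)) ∧ ∀ m : X, g (i m) = f m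

end AffineAlgebraicGroup

/-! A total integral `σ` plays the role of a Haar integral. Given a linear map `φ` from a rational
`H`-module to `k[G]`, the function `x ↦ x⁻¹ • φ (x • y)` on `H` is an element of `k[G] ⊗ k[H]`;
applying `a ⊗ b ↦ a * σ b` averages `φ` to an equivariant map, and `σ 1 = 1` leaves `φ y` unchanged
wherever that function is constant (`IsTotalIntegral.exists_average`).

Averaging a linear extension of an equivariant map gives injectivity of `k[G]`. Averaging a linear
section of `k[G] → k[H]` gives an injective total integral `s`, and then `M → M ⊗ k[H] → M ⊗ k[G]`,
the coaction followed by `s`, shows strong observability.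

Conversely, injectivity extends `k → k[G]` along `k → k[H]` to a total integral. Strong
observability applied to `k[H]` sends `1` to a nonzero `G`-invariant, and matrix coefficients of a
functional that is `1` on it form a total integral. -/

namespace AffineAlgebraicGroup

/-! ### Rational modules as modules with polynomial orbit maps -/

section EvalMap

variable {k : Type u} {G : Type v} [Field k] [Group G] (𝒢 : AffineAlgebraicGroup k G)
variable (M : Type*) [AddCommGroup M] [Module k M]

/-- An element of `M ⊗ k[G]`, viewed as an `M`-valued function on `G`. -/
noncomputable def evalMap : M ⊗[k] 𝒢.coordRing →ₗ[k] (G → M) :=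
  LinearMap.pi fun x =>
    (TensorProduct.rid k M).toLinearMap ∘ₗ (𝒢.evalAt x).toLinearMap.lTensor M

theorem evalMap_apply (t : M ⊗[k] 𝒢.coordRing) (x : G) :
    𝒢.evalMap M t x = TensorProduct.rid k M ((𝒢.evalAt x).toLinearMap.lTensor M t) := rfl

variable {M}

@[simp]
theorem evalMap_tmul (m : M) (f : 𝒢.coordRing) (x : G) :
    𝒢.evalMap M (m ⊗ₜ f) x = (f : G → k) x • m := by
  rw [evalMap_apply, LinearMap.lTensor_tmul, TensorProduct.rid_tmul]
  rfl

-- In a basis of `M`, a tensor is a finitely supported family of elements of `k[G]`, and these are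
-- honest functions on `G`.
variable (M) in
theorem evalMap_injective : Function.Injective (𝒢.evalMap M) := by
  classical
  rw [injective_iff_map_eq_zero]
  intro t ht
  let b := Module.Basis.ofVectorSpace k M
  have key : ∀ (s : M ⊗[k] 𝒢.coordRing) (x : G) i,
      b.repr (𝒢.evalMap M s x) i =
        (TensorProduct.equivFinsuppOfBasisLeft b s i : G → k) x := by
    intro s x i
    induction s using TensorProduct.induction_on with
    | zero => simp
    | tmul m f => simp [mul_comm]
    | add s s' hs hs' => simp [hs, hs']
  apply (TensorProduct.equivFinsuppOfBasisLeft b).injective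
  rw [map_zero]
  ext i x
  simp [← key, ht]

theorem evalMap_lTensor_regularRep (t : M ⊗[k] 𝒢.coordRing) (x y : G) :
    𝒢.evalMap M ((𝒢.regularRep y).lTensor M t) x = 𝒢.evalMap M t (x * y) := by
  induction t using TensorProduct.induction_on with
  | zero => simp
  | tmul m f =>
    rw [LinearMap.lTensor_tmul, evalMap_tmul, evalMap_tmul]
    rfl
  | add s s' hs hs' => simp [hs, hs']

/-- An `M`-valued function is polynomial if it comes from an element of `M ⊗ k[G]`. -/
def IsPolynomial (F : G → M) : Prop := F ∈ LinearMap.range (𝒢.evalMap M)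

variable {𝒢}

theorem IsPolynomial.sum {ι : Type*} (s : Finset ι) {F : ι → G → M}
    (h : ∀ i ∈ s, 𝒢.IsPolynomial (F i)) : 𝒢.IsPolynomial (fun x => ∑ i ∈ s, F i x) := by
  have := Submodule.sum_mem (LinearMap.range (𝒢.evalMap M)) h
  rwa [show (∑ i ∈ s, F i) = fun x => ∑ i ∈ s, F i x by ext; simp] at this

theorem IsPolynomial.add {F F' : G → M} (h : 𝒢.IsPolynomial F) (h' : 𝒢.IsPolynomial F') :
    𝒢.IsPolynomial (fun x => F x + F' x) :=
  Submodule.add_mem _ h h'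

theorem IsPolynomial.map {M' : Type*} [AddCommGroup M'] [Module k M'] {F : G → M}
    (h : 𝒢.IsPolynomial F) (L : M →ₗ[k] M') : 𝒢.IsPolynomial (fun x => L (F x)) := by
  obtain ⟨t, rfl⟩ := h
  refine ⟨L.rTensor _ t, ?_⟩
  funext x
  induction t using TensorProduct.induction_on with
  | zero => simp
  | tmul m f => simp
  | add s s' hs hs' => simp [hs, hs']

theorem IsPolynomial.smul {F : G → M} (h : 𝒢.IsPolynomial F) (a : 𝒢.coordRing) :
    𝒢.IsPolynomial (fun x => (a : G → k) x • F x) := by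
  obtain ⟨t, rfl⟩ := h
  refine ⟨(LinearMap.mulLeft k a).lTensor M t, ?_⟩
  funext x
  induction t using TensorProduct.induction_on with
  | zero => simp
  | tmul m f => simp [mul_smul]
  | add s s' hs hs' => simp [hs, hs']

theorem IsPolynomial.comp_inv {F : G → M} (h : 𝒢.IsPolynomial F) :
    𝒢.IsPolynomial (fun x => F x⁻¹) := by
  obtain ⟨t, rfl⟩ := h
  induction t using TensorProduct.induction_on with
  | zero => exact ⟨0, by ext; simp⟩
  | tmul m f => exact ⟨m ⊗ₜ ⟨_, 𝒢.inv_mem f f.2⟩, by ext; simp⟩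
  | add s s' hs hs' => simpa using hs.add hs'

theorem IsPolynomial.exists_sum {F : G → M} (h : 𝒢.IsPolynomial F) :
    ∃ (n : ℕ) (m : Fin n → M) (a : Fin n → 𝒢.coordRing),
      ∀ x, F x = ∑ i, (a i : G → k) x • m i := by
  obtain ⟨t, rfl⟩ := h
  obtain ⟨n, m, a, rfl⟩ := TensorProduct.exists_sum_tmul_eq t
  exact ⟨n, m, a, fun x => by simp⟩

theorem isPolynomial_tmul (m : M) (f : 𝒢.coordRing) :
    𝒢.IsPolynomial (fun x => (f : G → k) x • m) :=
  ⟨m ⊗ₜ f, by ext; simp⟩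

/-- The polynomial functions on `G` are the scalar-valued polynomial maps. -/
theorem IsPolynomial.mem_coordRing {F : G → k} (h : 𝒢.IsPolynomial F) : F ∈ 𝒢.coordRing := by
  obtain ⟨n, m, a, ha⟩ := h.exists_sum
  have : F = ∑ i, m i • (a i : G → k) := by
    funext x
    simp [ha, mul_comm]
  rw [this]
  exact Subalgebra.sum_mem _ fun i _ => Subalgebra.smul_mem _ (a i).2 _

/-- A linear family of polynomial functions lifts to a linear map into `M ⊗ k[G]`. -/
theorem exists_linear_lift {Y : Type*} [AddCommGroup Y] [Module k Y] (F : Y →ₗ[k] (G → M))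
    (hF : ∀ y, 𝒢.IsPolynomial (F y)) :
    ∃ Φ : Y →ₗ[k] M ⊗[k] 𝒢.coordRing, ∀ y, 𝒢.evalMap M (Φ y) = F y := by
  let e := LinearEquiv.ofInjective (𝒢.evalMap M) (𝒢.evalMap_injective M)
  refine ⟨e.symm.toLinearMap ∘ₗ F.codRestrict _ hF, fun y => ?_⟩
  have := congrArg Subtype.val (e.apply_symm_apply ⟨F y, hF y⟩)
  exact this

/-- Since `evalMap` is injective, the tensors representing the orbit maps are unique, so they depend
linearly on `m` and form a coaction. -/
theorem isRational_iff {ρ : Representation k G M} :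
    𝒢.IsRational ρ ↔ ∀ m, 𝒢.IsPolynomial (fun x => ρ x m) := by
  constructor
  · rintro ⟨χ, hχ⟩ m
    exact ⟨χ m, funext fun x => (hχ x m).symm⟩
  · intro h
    obtain ⟨Φ, hΦ⟩ := exists_linear_lift (LinearMap.pi fun x => ρ x) h
    exact ⟨Φ, fun x m => (congrFun (hΦ m) x).symm⟩

variable (𝒢) in
theorem isRational_regularRep : 𝒢.IsRational 𝒢.regularRep := by
  rw [isRational_iff]
  intro f
  obtain ⟨n, a, b, hab⟩ := 𝒢.exists_mul f f.2
  have : (fun x => 𝒢.regularRep x f) = fun x => ∑ i, (b i : G → k) x • a i := by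
    funext x
    apply Subtype.ext
    funext y
    refine (hab y x).trans ?_
    simp [mul_comm]
  rw [this]
  exact IsPolynomial.sum _ fun i _ => isPolynomial_tmul _ _

theorem isRational_trivial : 𝒢.IsRational (Representation.trivial k G M) := by
  rw [isRational_iff]
  intro m
  have := isPolynomial_tmul (𝒢 := 𝒢) m 1
  simpa using this

theorem IsRational.restrictRep {ρ : Representation k G M} (h : 𝒢.IsRational ρ) {H : Subgroup G}
    (hH : 𝒢.IsClosedSubgroup H) :
    (𝒢.closedSubgroup H hH).IsRational (restrictRep ρ H) := by
  rw [isRational_iff] at h ⊢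
  intro m
  obtain ⟨n, v, a, ha⟩ := (h m).exists_sum
  have : (fun x => AffineAlgebraicGroup.restrictRep ρ H x m) =
      fun x : H => ∑ i, (a i : G → k) x • v i := funext fun x => ha x
  rw [this]
  exact IsPolynomial.sum _ fun i _ => isPolynomial_tmul (𝒢 := 𝒢.closedSubgroup H hH) (v i)
    ⟨restrictFun k H (a i), Subalgebra.mem_map.2 ⟨a i, (a i).2, rfl⟩⟩

/-- Transport of a representation along a linear isomorphism. -/
def transportRep {M' : Type*} [AddCommGroup M'] [Module k M'] (ρ : Representation k G M)
    (e : M ≃ₗ[k] M') : Representation k G M' :=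
  (e.conjRingEquiv : Module.End k M →* Module.End k M').comp ρ

@[simp]
theorem transportRep_apply {M' : Type*} [AddCommGroup M'] [Module k M']
    (ρ : Representation k G M) (e : M ≃ₗ[k] M') (x : G) (m : M') :
    transportRep ρ e x m = e (ρ x (e.symm m)) := rfl

theorem IsRational.transportRep {M' : Type*} [AddCommGroup M'] [Module k M']
    {ρ : Representation k G M} (h : 𝒢.IsRational ρ) (e : M ≃ₗ[k] M') :
    𝒢.IsRational (transportRep ρ e) := by
  rw [isRational_iff] at h ⊢
  intro m
  exact (h (e.symm m)).map e.toLinearMap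

variable (𝒢 M) in
/-- The `G`-module `M ⊗ k[G]`, where `G` acts on the second factor only. -/
noncomputable def tensorRegularRep : Representation k G (M ⊗[k] 𝒢.coordRing) where
  toFun x := (𝒢.regularRep x).lTensor M
  map_one' := by rw [map_one, Module.End.one_eq_id, LinearMap.lTensor_id, Module.End.one_eq_id]
  map_mul' x y := by simp [LinearMap.lTensor_mul]

variable (𝒢 M) in
theorem isRational_tensorRegularRep : 𝒢.IsRational (𝒢.tensorRegularRep M) := by
  rw [isRational_iff]
  intro t
  induction t using TensorProduct.induction_on with
  | zero => exact ⟨0, by ext; simp⟩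
  | tmul m f =>
    exact (isRational_iff.1 𝒢.isRational_regularRep f).map (TensorProduct.mk k M _ m)
  | add s s' hs hs' => simpa using hs.add hs'

end EvalMap

/-! ### Averaging against a total integral -/

section Average

variable {k : Type u} {G : Type v} [Field k] [Group G] {𝒢 : AffineAlgebraicGroup k G}
variable {R : Type*} [CommRing R] [Algebra k R] {ρ : Representation k G R}
variable {Y : Type*} [AddCommGroup Y] [Module k Y] {τ : Representation k G Y}

/-- Averaging a linear map `φ : Y → R` with a total integral: the function `x ↦ x⁻¹ • φ (x • y)`,
as an element of `R ⊗ k[G]`, is sent to `R` by `a ⊗ b ↦ a * σ b`. -/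
theorem IsTotalIntegral.exists_average {σ : 𝒢.coordRing →ₗ[k] R} (hσ : 𝒢.IsTotalIntegral ρ σ)
    (hρ : 𝒢.IsRational ρ) (hmul : ∀ x a b, ρ x (a * b) = ρ x a * ρ x b)
    (hτ : 𝒢.IsRational τ) (φ : Y →ₗ[k] R) :
    ∃ g : Y →ₗ[k] R, (∀ x y, g (τ x y) = ρ x (g y)) ∧
      (∀ y, (∀ x, φ (τ x y) = ρ x (φ y)) → g y = φ y) ∧
      ∀ (ε : R →ₐ[k] k) (y : Y) (c : k), (∀ x, ε (ρ x⁻¹ (φ (τ x y))) = c) → ε (g y) = c := by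
  have hpoly : ∀ y, 𝒢.IsPolynomial (fun x => ρ x⁻¹ (φ (τ x y))) := by
    intro y
    obtain ⟨n, v, a, ha⟩ := (isRational_iff.1 hτ y).exists_sum
    simp only [ha, map_sum, map_smul]
    exact IsPolynomial.sum _ fun i _ => ((isRational_iff.1 hρ (φ (v i))).comp_inv).smul (a i)
  obtain ⟨Φ, hΦ⟩ := exists_linear_lift
    (LinearMap.pi fun x => ρ x⁻¹ ∘ₗ φ ∘ₗ τ x) hpoly
  replace hΦ : ∀ y x, 𝒢.evalMap R (Φ y) x = ρ x⁻¹ (φ (τ x y)) := fun y x => congrFun (hΦ y) x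
  let μ : R ⊗[k] 𝒢.coordRing →ₗ[k] R := LinearMap.mul' k R ∘ₗ σ.lTensor R
  have hμ : ∀ a b, μ (a ⊗ₜ b) = a * σ b := fun a b => by simp [μ]
  refine ⟨μ ∘ₗ Φ, fun z y => ?_, fun y hy => ?_, fun ε y c hc => ?_⟩
  -- This encodes `x⁻¹ • φ (x • z • y) = z • ((x * z)⁻¹ • φ ((x * z) • y))`.
  · have h1 : Φ (τ z y) = TensorProduct.map (ρ z) (𝒢.regularRep z) (Φ y) := by
      apply 𝒢.evalMap_injective R
      funext x
      have h2 : ∀ t : R ⊗[k] 𝒢.coordRing,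
          𝒢.evalMap R (TensorProduct.map (ρ z) (𝒢.regularRep z) t) x =
            ρ z (𝒢.evalMap R t (x * z)) := by
        intro t
        induction t using TensorProduct.induction_on with
        | zero => simp
        | tmul m f =>
          rw [TensorProduct.map_tmul, evalMap_tmul, evalMap_tmul, map_smul]
          rfl
        | add s s' hs hs' => simp [hs, hs']
      rw [h2, hΦ, hΦ, mul_inv_rev, map_mul, map_mul]
      simp only [Module.End.mul_apply]
      rw [← Module.End.mul_apply (ρ z), ← map_mul ρ z, mul_inv_cancel, map_one,
        Module.End.one_apply]
    have h3 : ∀ t : R ⊗[k] 𝒢.coordRing,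
        μ (TensorProduct.map (ρ z) (𝒢.regularRep z) t) = ρ z (μ t) := by
      intro t
      induction t using TensorProduct.induction_on with
      | zero => simp
      | tmul m f => rw [TensorProduct.map_tmul, hμ, hμ, hσ.1, hmul]
      | add s s' hs hs' => simp [hs, hs']
    simp only [LinearMap.comp_apply, h1, h3]
  · have h1 : Φ y = φ y ⊗ₜ 1 := by
      apply 𝒢.evalMap_injective R
      funext x
      rw [hΦ, evalMap_tmul, hy, ← Module.End.mul_apply, ← map_mul, inv_mul_cancel]
      simp
    simp [h1, hμ, hσ.2]
  -- `κ` is `ε ⊗ id`. As `ε` is multiplicative, `ε ∘ μ` factors through `κ`, and `κ (Φ y)` is the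
  -- constant function `c`.
  · let κ : R ⊗[k] 𝒢.coordRing →ₗ[k] 𝒢.coordRing :=
      (TensorProduct.lid k _).toLinearMap ∘ₗ ε.toLinearMap.rTensor _
    have h1 : ∀ t, ε (μ t) = ε (σ (κ t)) := by
      intro t
      induction t using TensorProduct.induction_on with
      | zero => simp
      | tmul m f => simp [hμ, κ]
      | add s s' hs hs' => simp [hs, hs']
    have h2 : ∀ t (x : G), (κ t : G → k) x = ε (𝒢.evalMap R t x) := by
      intro t x
      induction t using TensorProduct.induction_on with
      | zero => simp
      | tmul m f => simp [κ, mul_comm]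
      | add s s' hs hs' => simp [hs, hs']
    have h3 : κ (Φ y) = c • 1 := by
      apply Subtype.ext
      funext x
      rw [h2, hΦ, hc]
      simp
    simp [h1, h3, hσ.2]

end Average

/-! ### The equivalences -/

section Main

variable {k : Type u} {G : Type v} [Field k] [Group G] (𝒢 : AffineAlgebraicGroup k G)
  (H : Subgroup G) (hH : 𝒢.IsClosedSubgroup H)

/-- Restriction `k[G] → k[H]` of polynomial functions. -/
def restrictCoord : 𝒢.coordRing →ₗ[k] (𝒢.closedSubgroup H hH).coordRing :=
  (((restrictFun k H).comp 𝒢.coordRing.val).codRestrict (𝒢.closedSubgroup H hH).coordRing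
    (fun f => Subalgebra.mem_map.2 ⟨f, f.2, rfl⟩)).toLinearMap

theorem restrictCoord_surjective : Function.Surjective (𝒢.restrictCoord H hH) := by
  rintro ⟨g, hg⟩
  obtain ⟨f, hf, rfl⟩ := Subalgebra.mem_map.1 hg
  exact ⟨⟨f, hf⟩, rfl⟩

variable {𝒢 H hH}

theorem restrictRep_regularRep_apply (x : H) (f : 𝒢.coordRing) (y : G) :
    (restrictRep 𝒢.regularRep H x f : G → k) y = (f : G → k) (y * x) := rfl

theorem regularRep_apply (x : G) (f : 𝒢.coordRing) (y : G) :
    (𝒢.regularRep x f : G → k) y = (f : G → k) (y * x) := rfl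

theorem regularRep_one (x : G) : 𝒢.regularRep x 1 = 1 := rfl

/-- A total integral can be improved to an injective one: averaging a linear section of the
restriction map gives an equivariant section. -/
theorem exists_injective_totalIntegral
    {σ : (𝒢.closedSubgroup H hH).coordRing →ₗ[k] 𝒢.coordRing}
    (hσ : (𝒢.closedSubgroup H hH).IsTotalIntegral (restrictRep 𝒢.regularRep H) σ) :
    ∃ s : (𝒢.closedSubgroup H hH).coordRing →ₗ[k] 𝒢.coordRing,
      (𝒢.closedSubgroup H hH).IsTotalIntegral (restrictRep 𝒢.regularRep H) s ∧
      Function.Injective s := by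
  let r := 𝒢.restrictCoord H hH
  obtain ⟨φ₀, hφ₀⟩ := r.exists_rightInverse_of_surjective
    (LinearMap.range_eq_top.2 (𝒢.restrictCoord_surjective H hH))
  replace hφ₀ : ∀ f, r (φ₀ f) = f := fun f => DFunLike.congr_fun hφ₀ f
  -- The correction term makes the section unital; it stays a section because `1 - φ₀ 1` restricts
  -- to zero on `H`.
  let φ : (𝒢.closedSubgroup H hH).coordRing →ₗ[k] 𝒢.coordRing :=
    φ₀ + ((𝒢.closedSubgroup H hH).evalAt 1).toLinearMap.smulRight (1 - φ₀ 1)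
  have hφ_one : φ 1 = 1 := by simp [φ]
  have hφ : ∀ f, r (φ f) = f := by
    intro f
    have : r 1 = 1 := rfl
    simp [φ, hφ₀, this]
  obtain ⟨s, hs, hs_eq, hs_eval⟩ := hσ.exists_average
    (𝒢.isRational_regularRep.restrictRep hH) (fun _ _ _ => rfl)
    (𝒢.closedSubgroup H hH).isRational_regularRep φ
  refine ⟨s, ⟨hs, ?_⟩, ?_⟩
  · rw [hs_eq, hφ_one]
    intro x
    rw [regularRep_one, hφ_one]
    rfl
  -- Evaluated at `1`, the averaged function is `x ↦ φ (x • f) x⁻¹ = (x • f) x⁻¹ = f 1`, which is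
  -- constant in `x`.
  · have hs_one : ∀ f, (s f : G → k) 1 = (f : H → k) 1 := by
      intro f
      refine hs_eval (𝒢.evalAt 1) f _ fun x => ?_
      have h1 := congrFun (congrArg Subtype.val
        (hφ ((𝒢.closedSubgroup H hH).regularRep x f))) x⁻¹
      rw [regularRep_apply, inv_mul_cancel] at h1
      rw [← h1]
      change (φ _ : G → k) (1 * ((x⁻¹ : H) : G)) = (φ _ : G → k) ((x⁻¹ : H) : G)
      rw [one_mul]
    rw [injective_iff_map_eq_zero]
    intro f hf
    apply Subtype.ext
    funext x
    -- By equivariance, the value of `s f` at `x` is that of `s (x • f)` at `1`, namely `f x`.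
    have h1 := hs_one ((𝒢.closedSubgroup H hH).regularRep x f)
    rw [hs, hf, map_zero, regularRep_apply, one_mul] at h1
    exact h1.symm

theorem exists_totalIntegral_of_stronglyObservable
    (h : StronglyObservable.{u, v, max u v w} 𝒢 H hH) :
    ∃ σ : (𝒢.closedSubgroup H hH).coordRing →ₗ[k] 𝒢.coordRing,
      (𝒢.closedSubgroup H hH).IsTotalIntegral (restrictRep 𝒢.regularRep H) σ := by
  let A := (𝒢.closedSubgroup H hH).coordRing
  let e : A ≃ₗ[k] ULift.{w} A := ULift.moduleEquiv.symm
  obtain ⟨N, _, _, τ, hτ, ι, hι, hequiv, hinv⟩ := h (ULift.{w} A)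
    (transportRep (𝒢.closedSubgroup H hH).regularRep e)
    ((𝒢.closedSubgroup H hH).isRational_regularRep.transportRep e)
  have hone : ι (e 1) ∈ τ.invariants := by
    refine hinv _ fun x => ?_
    rw [transportRep_apply, e.symm_apply_apply, regularRep_one]
  have hne : ι (e 1) ≠ 0 := by
    rw [(map_ne_zero_iff ι hι), e.map_ne_zero_iff]
    intro h0
    exact one_ne_zero (congrFun (congrArg Subtype.val h0) 1)
  obtain ⟨l, hl⟩ : ∃ l : Module.Dual k N, l (ι (e 1)) ≠ 0 := by
    by_contra! hcon
    exact hne ((Module.forall_dual_apply_eq_zero_iff k _).1 hcon)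
  let c := (l (ι (e 1)))⁻¹
  -- Matrix coefficients of `c • l`; `G`-invariance of `ι (e 1)` makes `σ 1` constant, and `c`
  -- normalises it to `1`.
  let σ : A →ₗ[k] 𝒢.coordRing :=
    { toFun := fun f => ⟨fun x => c • l (τ x (ι (e f))),
        ((isRational_iff.1 hτ (ι (e f))).map (c • l)).mem_coordRing⟩
      map_add' := fun f g => by
        ext x
        simp [mul_add]
      map_smul' := fun a f => by
        ext x
        simp [mul_left_comm] }
  have hσ : ∀ f x, (σ f : G → k) x = c • l (τ x (ι (e f))) := fun _ _ => rfl
  refine ⟨σ, fun x f => ?_, ?_⟩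
  · apply Subtype.ext
    funext y
    have h1 := hequiv x (e f)
    rw [transportRep_apply, e.symm_apply_apply] at h1
    rw [hσ, h1, restrictRep_regularRep_apply, hσ, map_mul]
    rfl
  · apply Subtype.ext
    funext x
    rw [hσ, hone x]
    exact inv_mul_cancel₀ hl

theorem stronglyObservable_of_totalIntegral
    {σ : (𝒢.closedSubgroup H hH).coordRing →ₗ[k] 𝒢.coordRing}
    (hσ : (𝒢.closedSubgroup H hH).IsTotalIntegral (restrictRep 𝒢.regularRep H) σ) :
    StronglyObservable.{u, v, max u v w} 𝒢 H hH := by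
  obtain ⟨s, ⟨hs, hs_one⟩, hs_inj⟩ := exists_injective_totalIntegral hσ
  intro M _ _ ρ ⟨χ, hχ⟩
  replace hχ : ∀ m x, (𝒢.closedSubgroup H hH).evalMap M (χ m) x = ρ x m :=
    fun m x => (hχ x m).symm
  refine ⟨M ⊗[k] 𝒢.coordRing, inferInstance, inferInstance, 𝒢.tensorRegularRep M,
    𝒢.isRational_tensorRegularRep M, s.lTensor M ∘ₗ χ, ?_, fun x m => ?_, fun m hm => ?_⟩
  · rw [LinearMap.coe_comp]
    -- The coaction is injective because evaluating at `1` recovers `m`.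
    refine (Module.Flat.lTensor_preserves_injective_linearMap s hs_inj).comp fun m m' h => ?_
    simpa [hχ] using congrArg (fun t => (𝒢.closedSubgroup H hH).evalMap M t 1) h
  · have h1 : χ (ρ x m) = ((𝒢.closedSubgroup H hH).regularRep x).lTensor M (χ m) := by
      apply (𝒢.closedSubgroup H hH).evalMap_injective M
      funext y
      rw [evalMap_lTensor_regularRep, hχ, hχ, map_mul]
      rfl
    have h2 : s ∘ₗ (𝒢.closedSubgroup H hH).regularRep x = 𝒢.regularRep (x : G) ∘ₗ s :=
      LinearMap.ext fun f => hs x f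
    change s.lTensor M (χ (ρ x m)) = (𝒢.regularRep (x : G)).lTensor M (s.lTensor M (χ m))
    rw [h1, ← LinearMap.comp_apply, ← LinearMap.lTensor_comp, h2, LinearMap.lTensor_comp,
      LinearMap.comp_apply]
  · have h1 : χ m = m ⊗ₜ 1 := by
      apply (𝒢.closedSubgroup H hH).evalMap_injective M
      funext x
      rw [hχ, hm x, evalMap_tmul]
      simp
    intro x
    change (𝒢.regularRep x).lTensor M (s.lTensor M (χ m)) = s.lTensor M (χ m)
    rw [h1, LinearMap.lTensor_tmul, hs_one, LinearMap.lTensor_tmul, regularRep_one]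

theorem isInjectiveRational_of_totalIntegral
    {σ : (𝒢.closedSubgroup H hH).coordRing →ₗ[k] 𝒢.coordRing}
    (hσ : (𝒢.closedSubgroup H hH).IsTotalIntegral (restrictRep 𝒢.regularRep H) σ) :
    IsInjectiveRational.{u, v, w} (𝒢.closedSubgroup H hH) (restrictRep 𝒢.regularRep H) := by
  refine ⟨𝒢.isRational_regularRep.restrictRep hH, ?_⟩
  intro X Y _ _ _ _ ρX ρY _ hY i f hi hi_equiv hf_equiv
  obtain ⟨p, hp⟩ := i.exists_leftInverse_of_injective (LinearMap.ker_eq_bot.2 hi)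
  replace hp : ∀ m, p (i m) = m := fun m => DFunLike.congr_fun hp m
  -- The linear extension `f ∘ₗ p` is already equivariant on the image of `i`, so averaging does not
  -- change it there.
  obtain ⟨g, hg, hg_eq, -⟩ := hσ.exists_average
    (𝒢.isRational_regularRep.restrictRep hH) (fun _ _ _ => rfl) hY (f ∘ₗ p)
  refine ⟨g, hg, fun m => ?_⟩
  rw [hg_eq]
  · simp [hp]
  · intro x
    simp [← hi_equiv, hp, hf_equiv]

theorem exists_totalIntegral_of_isInjectiveRational
    (h : IsInjectiveRational.{u, v, max u v w} (𝒢.closedSubgroup H hH)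
      (restrictRep 𝒢.regularRep H)) :
    ∃ σ : (𝒢.closedSubgroup H hH).coordRing →ₗ[k] 𝒢.coordRing,
      (𝒢.closedSubgroup H hH).IsTotalIntegral (restrictRep 𝒢.regularRep H) σ := by
  let A := (𝒢.closedSubgroup H hH).coordRing
  let e : A ≃ₗ[k] ULift.{w} A := ULift.moduleEquiv.symm
  -- The lifts only move `k` and `k[H]` into the universe on which injectivity is tested.
  let d : ULift.{max v w} k ≃ₗ[k] k := ULift.moduleEquiv
  obtain ⟨g, hg, hgi⟩ := h.2 (ULift.{max v w} k) (ULift.{w} A)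
    (Representation.trivial k H _) (transportRep (𝒢.closedSubgroup H hH).regularRep e)
    isRational_trivial
    ((𝒢.closedSubgroup H hH).isRational_regularRep.transportRep e)
    (e.toLinearMap ∘ₗ Algebra.linearMap k A ∘ₗ d.toLinearMap)
    (Algebra.linearMap k 𝒢.coordRing ∘ₗ d.toLinearMap)
    (e.injective.comp ((algebraMap k A).injective.comp d.injective))
    (fun _ _ => rfl) (fun _ _ => rfl)
  refine ⟨g ∘ₗ e.toLinearMap, fun x f => ?_, ?_⟩
  · simpa using hg x (e f)
  · simpa using hgi (d.symm 1)

end Main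

end AffineAlgebraicGroup

theorem theorem4p3 {k : Type u} {G : Type v} [Field k] [IsAlgClosed k] [Group G]
    (𝒢 : AffineAlgebraicGroup k G) (H : Subgroup G) (hH : 𝒢.IsClosedSubgroup H) :
    (AffineAlgebraicGroup.StronglyObservable.{u, v, max u v w} 𝒢 H hH ↔
      ∃ σ : (𝒢.closedSubgroup H hH).coordRing →ₗ[k] 𝒢.coordRing,
        (𝒢.closedSubgroup H hH).IsTotalIntegral
          (AffineAlgebraicGroup.restrictRep 𝒢.regularRep H) σ) ∧
    ((∃ σ : (𝒢.closedSubgroup H hH).coordRing →ₗ[k] 𝒢.coordRing,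
        (𝒢.closedSubgroup H hH).IsTotalIntegral
          (AffineAlgebraicGroup.restrictRep 𝒢.regularRep H) σ) ↔
      AffineAlgebraicGroup.IsInjectiveRational.{u, v, max u v w} (𝒢.closedSubgroup H hH)
        (AffineAlgebraicGroup.restrictRep 𝒢.regularRep H)) := by
  exact ⟨⟨AffineAlgebraicGroup.exists_totalIntegral_of_stronglyObservable.{u, v, w},
      fun ⟨_, hσ⟩ => AffineAlgebraicGroup.stronglyObservable_of_totalIntegral.{u, v, w} hσ⟩,
    fun ⟨_, hσ⟩ => AffineAlgebraicGroup.isInjectiveRational_of_totalIntegral.{u, v, max u v w} hσ,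
    AffineAlgebraicGroup.exists_totalIntegral_of_isInjectiveRational.{u, v, w}⟩
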